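/- **Lemma.** The category of counital Hopf bimodules and the category of generalized counital $C^*$-bialgebras are equivalent. All $C^*$-algebras here are unital and finite-dimensional, $\otimes$ is the tensor product over $\mathbb C$, $\varsigma$ is the flip of $M\otimes M$, and all homomorphisms and anti-homomorphisms are linear. *Generalized counital $C^*$-bialgebras.* An object is a triple $(M,\Delta,S)$, where $M$ is a $C^*$-algebra, $\Delta:M\to M\otimes M$ is an injective, not necessarily unital, $*$-homomorphism with $(\Delta\otimes\mathrm{id})\Delta=(\mathrm{id}\otimes\Delta)\Delta$, and $S:M\to M$ is a unital anti-$*$-automorphism with $S^2=\mathrm{id}$ and $(S\otimes S)\Delta=\varsigma\Delta S$. Put $e=\Delta(1)$, $$N_s=\{x\in M:\Delta(x)=e(1\otimes x)=(1\otimes x)e\},\qquad N_t=\{x\in M:\Delta(x)=e(x\otimes1)=(x\otimes1)e\},$$ and $\varepsilon_t=\mu(\mathrm{id}\otimes S)\Delta:M\to M$, where $\mu(x\otimes y)=xy$. It is required that (1) $\varepsilon_t(1)=1$; (2) $\varepsilon_t(M)\subset N_t$; (3) $(\mathrm{id}\otimes\varepsilon_t)\Delta(x)=e(x\otimes1)$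 for all $x\in N_s$. A morphism $(M_1,\Delta_1,S_1)\to(M_2,\Delta_2,S_2)$ is a unital $*$-homomorphism $\pi:M_1\to M_2$ with $(\pi\otimes\pi)\Delta_1=\Delta_2\pi$ and $\pi S_1=S_2\pi$. *Fibered products.* Let $\beta:N\to M_1$ be a unital anti-$*$-homomorphism and $\gamma:N\to M_2$ a unital $*$-homomorphism. With $M_1$ and $M_2$ acting on themselves by left multiplication (the standard representation), the relative tensor product is the quotient of $M_1\otimes M_2$ by the span of the vectors $\beta(n)\zeta\otimes\eta-\zeta\otimes\gamma(n)\eta$. There is a unique projection $e_{\beta,\gamma}\in M_1\otimes M_2$ such that the kernel of left multiplication by $e_{\beta,\gamma}$ is this span; it is the support of the quotient map. The fibered product is the reduced algebra $M_1\,{}_\beta{*}_\gamma\,M_2=e_{\beta,\gamma}(M_1\otimes M_2)e_{\beta,\gamma}$ with unit $e_{\beta,\gamma}$ (equivalently, the commutant on the relative tensor product of the algebra generated by the operators $x\otimes_N y$, $x\in M_1'$, $y\in M_2'$), and $i$ denotes its inclusion into $M_1\otimes M_2$. For $x\in M_1$ commuting with $\beta(N)$ and $y\in M_2$ commuting with $\gamma(N)$,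 the element $x\,{}_\beta{\otimes}_\gamma\,y$ is $e_{\beta,\gamma}(x\otimes y)e_{\beta,\gamma}$. For unital $*$-homomorphisms $\Phi:M_1\to L_1$ and $\Psi:M_2\to L_2$, the map $\Phi*\Psi:M_1\,{}_\beta{*}_\gamma\,M_2\to L_1\,{}_{\Phi\beta}{*}_{\Psi\gamma}\,L_2$ is the restriction of $\Phi\otimes\Psi$. *Counital Hopf bimodules.* An object consists of $C^*$-algebras $N$, $M$, an injective unital $*$-homomorphism $t:N\to M$, a unital anti-$*$-automorphism $S$ of $M$ with $S^2=\mathrm{id}$, and, with $s=S\circ t$, an injective unital $*$-homomorphism $\Delta:M\to M\,{}_s{*}_t\,M$ such that for all $n,n'\in N$ $$s(n)t(n')=t(n')s(n),\qquad \Delta(t(n))=t(n)\,{}_s{\otimes}_t\,1,\qquad \Delta(s(n))=1\,{}_s{\otimes}_t\,s(n),$$ $(\Delta*\mathrm{id})\Delta=(\mathrm{id}*\Delta)\Delta$ (as elements of $M\otimes M\otimes M$, in which both triple fibered products lie), and $(S*S)\Delta=\varsigma\Delta S$ (as elements of $M\otimes M$). Here $S$ is regarded as a $*$-homomorphism into the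 opposite algebra $M^o$. With $\epsilon_t=\mu(\mathrm{id}*S)\Delta:M\to M$, where $\mathrm{id}*S$ takes values in $M\,{}_s{*}_s\,M^o\subset M\otimes M^o$ and $\mu(x\otimes y)=xy$, it is required that (1) $\epsilon_t(1)=1$; (2) $\epsilon_t(M)\subset t(N)$; (3) $\epsilon_t(t(n)s(n')x)=t(n)\epsilon_t(x)t(n')$ for all $n,n'\in N$, $x\in M$. A morphism $(N_1,M_1,t_1,\Delta_1,S_1)\to(N_2,M_2,t_2,\Delta_2,S_2)$ is a pair of unital $*$-homomorphisms $f:N_1\to N_2$, $\pi:M_1\to M_2$ with $\pi t_1=t_2f$, $\pi S_1=S_2\pi$, and $(\pi*\pi)\Delta_1=\Delta_2\pi$ (as elements of $M_2\otimes M_2$, where $\pi*\pi$ is the restriction of $\pi\otimes\pi$). -/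

import Mathlib

open scoped TensorProduct
open CategoryTheory

universe u

set_option linter.unusedSectionVars false

section RegularTrace

variable {N : Type*} [CStarAlgebra N] [FiniteDimensional ℂ N]

/-- The trace of the left regular representation, `x ↦ Tr L_x`. -/
noncomputable def regTrace (N : Type*) [Ring N] [Algebra ℂ N] : N →ₗ[ℂ] ℂ :=
  LinearMap.trace ℂ N ∘ₗ (Algebra.lmul ℂ N).toLinearMap

theorem regTrace_mul_comm (x y : N) : regTrace N (x * y) = regTrace N (y * x) := by
  change LinearMap.trace ℂ N (Algebra.lmul ℂ N (x * y)) = LinearMap.trace ℂ N (Algebra.lmul ℂ N (y * x))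
  rw [map_mul (Algebra.lmul ℂ N), map_mul (Algebra.lmul ℂ N), LinearMap.trace_mul_comm]

theorem regTrace_eq (a : N) : regTrace N a = ((Algebra.lmul ℂ N a).charpoly.roots).sum := by
  exact Module.End.trace_eq_sum_roots_charpoly_of_splits (IsAlgClosed.splits _)

theorem regTrace_roots (a : N) (μ : ℂ) (h : μ ∈ (Algebra.lmul ℂ N a).charpoly.roots) :
    μ ∈ spectrum ℂ a := by
  have h1 : μ ∈ spectrum ℂ (Algebra.lmul ℂ N a) := by
    rw [Module.End.mem_spectrum_iff_isRoot_charpoly]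
    exact Polynomial.isRoot_of_mem_roots h
  exact AlgHom.spectrum_apply_subset _ _ h1

theorem regTrace_star (a : N) : regTrace N (star a) = star (regTrace N a) := by
  have key : ∀ h : N, IsSelfAdjoint h → star (regTrace N h) = regTrace N h := by
    intro h hh
    rw [regTrace_eq]
    have : ∀ s : Multiset ℂ, (∀ μ ∈ s, star μ = μ) → star s.sum = s.sum := by
      intro s
      induction s using Multiset.induction_on with
      | empty => simp
      | cons a s ih =>
        intro hs
        simp only [Multiset.sum_cons, star_add]
        rw [ih (fun μ hμ => hs μ (Multiset.mem_cons_of_mem hμ)), hs a (Multiset.mem_cons_self a s)]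
    apply this
    intro μ hμ
    have := hh.mem_spectrum_eq_re (regTrace_roots _ _ hμ)
    rw [this]; simp
  have h1 := key _ (realPart a).2
  have h2 := key _ (imaginaryPart a).2
  conv_lhs => rw [← realPart_add_I_smul_imaginaryPart a]
  conv_rhs => rw [← realPart_add_I_smul_imaginaryPart a]
  simp only [star_add, star_smul, map_add, map_smul, h1, h2, (realPart a).2.star_eq, (imaginaryPart a).2.star_eq]

open scoped ComplexOrder in
theorem regTrace_faithful (x : N) (h : regTrace N (star x * x) = 0) : x = 0 := by
  set a := star x * x with ha
  have hsa : IsSelfAdjoint a := IsSelfAdjoint.star_mul_self x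
  have hpos : ∀ μ ∈ (Algebra.lmul ℂ N a).charpoly.roots, 0 ≤ μ := by
    intro μ hμ
    have h1 := regTrace_roots _ _ hμ
    have h2 := hsa.mem_spectrum_eq_re h1
    rw [h2] at h1 ⊢
    have h3 : μ.re ∈ spectrum ℝ a := by
      rw [spectrum.mem_iff] at h1 ⊢
      rwa [IsScalarTower.algebraMap_apply ℝ ℂ N]
    have := spectrum_star_mul_self_nonneg _ h3
    exact_mod_cast this
  rw [regTrace_eq] at h
  have h0 : ∀ μ ∈ (Algebra.lmul ℂ N a).charpoly.roots, μ = 0 := by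
    have : ∀ s : Multiset ℂ, (∀ μ ∈ s, 0 ≤ μ) → 0 ≤ s.sum ∧ (s.sum = 0 → ∀ μ ∈ s, μ = 0) := by
      intro s
      induction s using Multiset.induction_on with
      | empty => simp
      | cons b s ih =>
        intro hs
        obtain ⟨i1, i2⟩ := ih (fun μ hμ => hs μ (Multiset.mem_cons_of_mem hμ))
        have hb := hs b (Multiset.mem_cons_self b s)
        rw [Multiset.sum_cons]
        refine ⟨add_nonneg hb i1, fun h0 => ?_⟩
        obtain ⟨j1, j2⟩ := (add_eq_zero_iff_of_nonneg hb i1).1 h0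
        intro μ hμ
        rcases Multiset.mem_cons.1 hμ with rfl | hμ
        · exact j1
        · exact i2 j2 μ hμ
    exact (this _ hpos).2 h
  have hnil : (Algebra.lmul ℂ N a) ^ Module.finrank ℂ N = 0 := by
    have hs := (IsAlgClosed.splits (Algebra.lmul ℂ N a).charpoly)
    have h3 := Multiset.eq_replicate_card.2 h0
    have h2 := hs.eq_prod_roots_of_monic (LinearMap.charpoly_monic _)
    rw [h3] at h2
    have h4 : (Algebra.lmul ℂ N a).charpoly.roots.card = Module.finrank ℂ N := by
      rw [← hs.natDegree_eq_card_roots, LinearMap.charpoly_natDegree]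
    have h5 := LinearMap.aeval_self_charpoly (Algebra.lmul ℂ N a)
    rw [h2] at h5
    rw [h4] at h5
    simpa using h5
  have hn : a ^ Module.finrank ℂ N = 0 := by
    have := congrArg (fun f => f 1) hnil
    rw [← map_pow] at this
    simpa using this
  have ha0 : a = 0 := by
    have hlt : Module.finrank ℂ N ≤ 2 ^ Module.finrank ℂ N := Nat.lt_two_pow_self.le
    have h1 : a ^ 2 ^ Module.finrank ℂ N = 0 := pow_eq_zero_of_le hlt hn
    have h2 := hsa.nnnorm_pow_two_pow (Module.finrank ℂ N)
    rw [h1] at h2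
    have : ‖a‖₊ ^ 2 ^ Module.finrank ℂ N = 0 := by rw [← h2]; simp
    simpa using this
  exact CStarRing.star_mul_self_eq_zero_iff x |>.1 ha0

section
variable (N)
/-- The trace form `(x, y) ↦ Tr L_{xy}` of the left regular representation. -/
noncomputable def regForm : LinearMap.BilinForm ℂ N := (LinearMap.mul ℂ N).compr₂ (regTrace N)
end

theorem regForm_apply (x y : N) : regForm N x y = regTrace N (x * y) := rfl

theorem regForm_nondegenerate : (regForm N).Nondegenerate := by
  have hs : ∀ x y, regForm N x y = regForm N y x := fun x y => regTrace_mul_comm x y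
  have hl : ∀ x : N, (∀ y, regForm N x y = 0) → x = 0 := by
    intro x hx
    apply regTrace_faithful x
    rw [regTrace_mul_comm]
    exact hx (star x)
  constructor
  · exact hl
  · intro x hx
    apply hl
    intro y
    rw [hs]
    exact hx y

/-- Dual bases of a f-d C*-algebra for the regular trace form. -/
theorem exists_casimir (N : Type*) [CStarAlgebra N] [FiniteDimensional ℂ N] :
    ∃ (n : ℕ) (b d : Fin n → N),
      (∀ x, ∑ i, regTrace N (d i * x) • b i = x) ∧ (∀ x, ∑ i, regTrace N (b i * x) • d i = x) ∧
      ∑ i, d i * b i = 1 := by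
  let B := Module.finBasis ℂ N
  let D := (regForm N).dualBasis regForm_nondegenerate B
  have hsym : (regForm N).IsSymm := ⟨fun x y => regTrace_mul_comm x y⟩
  have hD : ∀ x i, D.repr x i = regTrace N (B i * x) := fun x i => by
    rw [regTrace_mul_comm]
    exact LinearMap.BilinForm.dualBasis_repr_apply _ _ _ _
  have hB : ∀ x i, B.repr x i = regTrace N (D i * x) := fun x i => by
    conv_rhs => rw [← B.sum_repr x]
    simp only [Finset.mul_sum, mul_smul_comm, map_sum, map_smul]
    have : ∀ j, regTrace N (D i * B j) = if j = i then 1 else 0 := fun j =>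
      LinearMap.BilinForm.apply_dualBasis_left regForm_nondegenerate B i j
    simp [this]
  refine ⟨_, B, D, fun x => ?_, fun x => ?_, ?_⟩
  · simp only [← hB]; exact B.sum_repr x
  · simp only [← hD]; exact D.sum_repr x
  · rw [← sub_eq_zero]
    apply regForm_nondegenerate.2
    intro y
    rw [map_sub, sub_eq_zero, regForm_apply, regForm_apply, mul_one, Finset.mul_sum, map_sum]
    have h1 : regTrace N y = ∑ i, D.repr (y * D i) i := by
      change LinearMap.trace ℂ N (Algebra.lmul ℂ N y) = _
      rw [LinearMap.trace_eq_matrix_trace ℂ D, Matrix.trace]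
      simp [LinearMap.toMatrix_apply]
    rw [h1]
    refine Finset.sum_congr rfl fun i _ => ?_
    rw [hD, regTrace_mul_comm (B i), mul_assoc]

end RegularTrace

section FiberedProduct

variable {N : Type*} [CStarAlgebra N] [FiniteDimensional ℂ N]
variable {M₁ M₂ : Type*}
  [Ring M₁] [StarRing M₁] [Algebra ℂ M₁] [StarModule ℂ M₁]
  [Ring M₂] [StarRing M₂] [Algebra ℂ M₂] [StarModule ℂ M₂]
variable {L₁ L₂ : Type*}
  [Ring L₁] [StarRing L₁] [Algebra ℂ L₁] [StarModule ℂ L₁]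
  [Ring L₂] [StarRing L₂] [Algebra ℂ L₂] [StarModule ℂ L₂]

/-- The span of the vectors `β(n)ζ ⊗ η - ζ ⊗ γ(n)η`. Here `β` is an anti-`*`-homomorphism `N → M₁`,
encoded as a `*`-homomorphism on the opposite algebra, `γ : N → M₂` is a `*`-homomorphism, and `M₁`,
`M₂` act by left multiplication on themselves (the standard representation). -/
def balanced (β : Nᵐᵒᵖ →⋆ₐ[ℂ] M₁) (γ : N →⋆ₐ[ℂ] M₂) : Submodule ℂ (M₁ ⊗[ℂ] M₂) :=
  Submodule.span ℂ {w | ∃ (n : N) (x : M₁) (y : M₂),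
    w = (β (.op n) * x) ⊗ₜ[ℂ] y - x ⊗ₜ[ℂ] (γ n * y)}

/-- The relative tensor product `M₁ β⊗γ M₂` over `N` of the standard representation spaces. -/
abbrev RelTensor (β : Nᵐᵒᵖ →⋆ₐ[ℂ] M₁) (γ : N →⋆ₐ[ℂ] M₂) : Type _ :=
  (M₁ ⊗[ℂ] M₂) ⧸ balanced β γ

/-- The canonical map `A_{β,γ} : ζ ⊗ η ↦ ζ β⊗γ η` onto the relative tensor product. -/
def relMk (β : Nᵐᵒᵖ →⋆ₐ[ℂ] M₁) (γ : N →⋆ₐ[ℂ] M₂) : M₁ ⊗[ℂ] M₂ →ₗ[ℂ] RelTensor β γ :=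
  (balanced β γ).mkQ

/-- `e` is the support of `A_{β,γ}`: an orthogonal projection of `M₁ ⊗ M₂` whose kernel (in the
standard representation) is the kernel of `A_{β,γ}`. -/
structure IsSupport (β : Nᵐᵒᵖ →⋆ₐ[ℂ] M₁) (γ : N →⋆ₐ[ℂ] M₂) (e : M₁ ⊗[ℂ] M₂) : Prop where
  idem : e * e = e
  star_eq : star e = e
  ker : ∀ z, e * z = 0 ↔ relMk β γ z = 0

theorem relMk_eq_zero (β : Nᵐᵒᵖ →⋆ₐ[ℂ] M₁) (γ : N →⋆ₐ[ℂ] M₂) (z : M₁ ⊗[ℂ] M₂) :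
    relMk β γ z = 0 ↔ z ∈ balanced β γ := by
  simp [relMk]

theorem mul_balanced {β : Nᵐᵒᵖ →⋆ₐ[ℂ] M₁} {γ : N →⋆ₐ[ℂ] M₂} {e : M₁ ⊗[ℂ] M₂}
    (h : ∀ n, e * (β (.op n) ⊗ₜ 1) = e * (1 ⊗ₜ γ n)) {z : M₁ ⊗[ℂ] M₂} (hz : z ∈ balanced β γ) :
    e * z = 0 := by
  refine Submodule.span_induction ?_ (mul_zero _) (fun x y _ _ hx hy => by rw [mul_add, hx, hy, add_zero])
    (fun c x _ hx => by rw [mul_smul_comm, hx, smul_zero]) hz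
  rintro _ ⟨n, x, y, rfl⟩
  have := congrArg (· * (x ⊗ₜ[ℂ] y)) (h n)
  simp only [mul_assoc, Algebra.TensorProduct.tmul_mul_tmul, one_mul] at this
  rw [mul_sub, this, sub_self]

theorem exists_isSupport (β : Nᵐᵒᵖ →⋆ₐ[ℂ] M₁) (γ : N →⋆ₐ[ℂ] M₂) : ∃ e, IsSupport β γ e := by
  obtain ⟨k, b, d, hb, hd, hone⟩ := exists_casimir N
  let e : M₁ ⊗[ℂ] M₂ := ∑ i, β (.op (d i)) ⊗ₜ γ (b i)
  have hbal : ∀ n, e * (β (.op n) ⊗ₜ 1) = e * (1 ⊗ₜ γ n) := by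
    intro n
    simp only [e, Finset.sum_mul, Algebra.TensorProduct.tmul_mul_tmul, mul_one, ← map_mul,
      ← MulOpposite.op_mul]
    have h1 : ∀ i, β (.op (n * d i)) ⊗ₜ[ℂ] γ (b i) =
        ∑ j, regTrace N (b j * (n * d i)) • (β (.op (d j)) ⊗ₜ[ℂ] γ (b i)) := by
      intro i
      conv_lhs => rw [← hd (n * d i)]
      simp only [Finset.op_sum, MulOpposite.op_smul, map_sum, map_smul, TensorProduct.sum_tmul,
        TensorProduct.smul_tmul']
    have h2 : ∀ j, β (.op (d j)) ⊗ₜ[ℂ] γ (b j * n) =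
        ∑ i, regTrace N (b j * (n * d i)) • (β (.op (d j)) ⊗ₜ[ℂ] γ (b i)) := by
      intro j
      conv_lhs => rw [← hb (b j * n)]
      simp only [map_sum, map_smul, TensorProduct.tmul_sum, TensorProduct.tmul_smul]
      refine Finset.sum_congr rfl fun i _ => ?_
      rw [regTrace_mul_comm (d i), mul_assoc]
    simp only [h1, h2]
    exact Finset.sum_comm
  have hsub : ∀ z, z - e * z ∈ balanced β γ := by
    intro z
    induction z with
    | zero => simp
    | add z w hz hw => rw [mul_add, add_sub_add_comm]; exact add_mem hz hw
    | tmul x y =>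
      have h1 : x ⊗ₜ[ℂ] y = ∑ i, x ⊗ₜ[ℂ] (γ (d i) * (γ (b i) * y)) := by
        rw [← TensorProduct.tmul_sum]
        simp only [← mul_assoc, ← map_mul]
        rw [← Finset.sum_mul, ← map_sum, hone, map_one, one_mul]
      have h2 : e * (x ⊗ₜ[ℂ] y) = ∑ i, (β (.op (d i)) * x) ⊗ₜ[ℂ] (γ (b i) * y) := by
        simp only [e, Finset.sum_mul, Algebra.TensorProduct.tmul_mul_tmul]
      rw [h2, h1, ← Finset.sum_sub_distrib]
      refine sum_mem fun i _ => ?_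
      rw [← neg_sub]
      exact neg_mem (Submodule.subset_span ⟨d i, x, γ (b i) * y, rfl⟩)
  refine ⟨e, ?_, ?_, fun z => ?_⟩
  · have := mul_balanced hbal (hsub 1)
    rw [mul_one, mul_sub, mul_one, sub_eq_zero] at this
    exact this.symm
  · have hbs : ∀ j, b j = ∑ i, regTrace N (star (d i) * b j) • star (b i) := by
      intro j
      conv_lhs => rw [← star_star (b j), ← hb (star (b j))]
      simp only [star_sum, star_smul, ← regTrace_star, star_mul, star_star]
      refine Finset.sum_congr rfl fun i _ => ?_
      rw [regTrace_mul_comm]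
    have h1 : ∀ i, β (.op (star (d i))) ⊗ₜ[ℂ] γ (star (b i)) =
        ∑ j, regTrace N (star (d i) * b j) • (β (.op (d j)) ⊗ₜ[ℂ] γ (star (b i))) := by
      intro i
      conv_lhs => rw [← hd (star (d i))]
      simp only [Finset.op_sum, MulOpposite.op_smul, map_sum, map_smul, TensorProduct.sum_tmul,
        TensorProduct.smul_tmul']
      refine Finset.sum_congr rfl fun j _ => ?_
      rw [regTrace_mul_comm]
    have h2 : ∀ j, β (.op (d j)) ⊗ₜ[ℂ] γ (b j) =
        ∑ i, regTrace N (star (d i) * b j) • (β (.op (d j)) ⊗ₜ[ℂ] γ (star (b i))) := by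
      intro j
      conv_lhs => rw [hbs j]
      simp only [map_sum, map_smul, TensorProduct.tmul_sum, TensorProduct.tmul_smul]
    simp only [e, star_sum, TensorProduct.star_tmul, ← map_star, ← MulOpposite.op_star]
    simp only [h1]
    rw [Finset.sum_comm]
    exact Finset.sum_congr rfl fun j _ => (h2 j).symm
  · rw [relMk_eq_zero]
    refine ⟨fun h => ?_, mul_balanced hbal⟩
    have := hsub z
    rwa [h, sub_zero] at this

/-- The projection `e_{β,γ} ∈ M₁ ⊗ M₂`, the support of `A_{β,γ}`. -/
noncomputable def supportProj (β : Nᵐᵒᵖ →⋆ₐ[ℂ] M₁) (γ : N →⋆ₐ[ℂ] M₂) : M₁ ⊗[ℂ] M₂ :=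
  (exists_isSupport β γ).choose

theorem supportProj_spec (β : Nᵐᵒᵖ →⋆ₐ[ℂ] M₁) (γ : N →⋆ₐ[ℂ] M₂) :
    IsSupport β γ (supportProj β γ) :=
  (exists_isSupport β γ).choose_spec

theorem IsSupport.sub_mul_mem {β : Nᵐᵒᵖ →⋆ₐ[ℂ] M₁} {γ : N →⋆ₐ[ℂ] M₂} {e : M₁ ⊗[ℂ] M₂}
    (h : IsSupport β γ e) (z : M₁ ⊗[ℂ] M₂) : z - e * z ∈ balanced β γ := by
  rw [← relMk_eq_zero, ← h.ker, mul_sub, ← mul_assoc, h.idem, sub_self]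

theorem IsSupport.mul_eq_zero {β : Nᵐᵒᵖ →⋆ₐ[ℂ] M₁} {γ : N →⋆ₐ[ℂ] M₂} {e : M₁ ⊗[ℂ] M₂}
    (h : IsSupport β γ e) {z : M₁ ⊗[ℂ] M₂} (hz : z ∈ balanced β γ) : e * z = 0 := by
  rwa [h.ker, relMk_eq_zero]

/-- The support projection is unique. -/
theorem IsSupport.unique {β : Nᵐᵒᵖ →⋆ₐ[ℂ] M₁} {γ : N →⋆ₐ[ℂ] M₂} {e f : M₁ ⊗[ℂ] M₂}
    (he : IsSupport β γ e) (hf : IsSupport β γ f) : e = f := by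
  have h1 : e = e * f := by
    have := he.mul_eq_zero (hf.sub_mul_mem 1)
    rwa [mul_one, mul_sub, mul_one, sub_eq_zero] at this
  have h2 : f = f * e := by
    have := hf.mul_eq_zero (he.sub_mul_mem 1)
    rwa [mul_one, mul_sub, mul_one, sub_eq_zero] at this
  have h3 := congrArg star h2
  rw [star_mul, hf.star_eq, he.star_eq] at h3
  exact h1.trans h3.symm

/-- The reduced algebra `e (M₁ ⊗ M₂) e`, `e = e_{β,γ}`, as a non-unital subalgebra. -/
noncomputable def fiberedSubalgebra (β : Nᵐᵒᵖ →⋆ₐ[ℂ] M₁) (γ : N →⋆ₐ[ℂ] M₂) :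
    NonUnitalStarSubalgebra ℂ (M₁ ⊗[ℂ] M₂) where
  carrier := {z | supportProj β γ * z = z ∧ z * supportProj β γ = z}
  add_mem' := fun {a b} ha hb => ⟨by rw [mul_add, ha.1, hb.1], by rw [add_mul, ha.2, hb.2]⟩
  zero_mem' := ⟨mul_zero _, zero_mul _⟩
  mul_mem' := fun {a b} ha hb => ⟨by rw [← mul_assoc, ha.1], by rw [mul_assoc, hb.2]⟩
  smul_mem' := fun c x hx => ⟨by rw [mul_smul_comm, hx.1], by rw [smul_mul_assoc, hx.2]⟩
  star_mem' := fun {a} ha => by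
    have h := (supportProj_spec β γ).star_eq
    have h1 := congrArg star ha.1
    have h2 := congrArg star ha.2
    rw [star_mul, h] at h1 h2
    exact ⟨h2, h1⟩

/-- The fibered product `M₁ β*γ M₂` over `N`: the algebra `M₁ ⊗ M₂` reduced by `e_{β,γ}`, a unital
`*`-algebra with unit `e_{β,γ}`. -/
def FiberedProduct (β : Nᵐᵒᵖ →⋆ₐ[ℂ] M₁) (γ : N →⋆ₐ[ℂ] M₂) : Type _ := fiberedSubalgebra β γ

namespace FiberedProduct

variable (β : Nᵐᵒᵖ →⋆ₐ[ℂ] M₁) (γ : N →⋆ₐ[ℂ] M₂)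

noncomputable instance : NonUnitalRing (FiberedProduct β γ) :=
  inferInstanceAs (NonUnitalRing (fiberedSubalgebra β γ))

noncomputable instance : Ring (FiberedProduct β γ) where
  one := ⟨supportProj β γ, (supportProj_spec β γ).idem, (supportProj_spec β γ).idem⟩
  one_mul a := Subtype.ext a.2.1
  mul_one a := Subtype.ext a.2.2

noncomputable instance : StarRing (FiberedProduct β γ) :=
  inferInstanceAs (StarRing (fiberedSubalgebra β γ))

noncomputable instance : Module ℂ (FiberedProduct β γ) :=
  inferInstanceAs (Module ℂ (fiberedSubalgebra β γ))

noncomputable instance : Algebra ℂ (FiberedProduct β γ) :=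
  Algebra.ofModule
    (fun c x y => Subtype.ext (smul_mul_assoc c (x.1 : M₁ ⊗[ℂ] M₂) y.1))
    (fun c x y => Subtype.ext (mul_smul_comm c (x.1 : M₁ ⊗[ℂ] M₂) y.1))

instance : StarModule ℂ (FiberedProduct β γ) where
  star_smul c x := Subtype.ext (star_smul c (x.1 : M₁ ⊗[ℂ] M₂))

/-- The canonical (non-unital) injection `i_{β,γ}` of the fibered product into `M₁ ⊗ M₂`. -/
noncomputable def incl : FiberedProduct β γ →⋆ₙₐ[ℂ] M₁ ⊗[ℂ] M₂ where
  toFun x := x.1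
  map_smul' _ _ := rfl
  map_zero' := rfl
  map_add' _ _ := rfl
  map_mul' _ _ := rfl
  map_star' _ := rfl

/-- The element `x β⊗γ y` of the fibered product, for `x` commuting with `β(N)` and `y` commuting
with `γ(N)`; in `M₁ ⊗ M₂` it is the reduction `e (x ⊗ y) e`. -/
noncomputable def elem (x : M₁) (y : M₂) : FiberedProduct β γ :=
  ⟨supportProj β γ * (x ⊗ₜ y) * supportProj β γ,
    by rw [← mul_assoc, ← mul_assoc, (supportProj_spec β γ).idem],
    by rw [mul_assoc, (supportProj_spec β γ).idem]⟩

variable {β γ}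

theorem tensorMap_star (Φ : M₁ →⋆ₐ[ℂ] L₁) (Ψ : M₂ →⋆ₐ[ℂ] L₂) (z : M₁ ⊗[ℂ] M₂) :
    Algebra.TensorProduct.map Φ.toAlgHom Ψ.toAlgHom (star z) =
      star (Algebra.TensorProduct.map Φ.toAlgHom Ψ.toAlgHom z) := by
  induction z with
  | zero => simp
  | add z w hz hw => simp only [star_add, map_add, hz, hw]
  | tmul x y =>
    have h1 : Φ.toAlgHom (star x) = star (Φ.toAlgHom x) := map_star Φ x
    have h2 : Ψ.toAlgHom (star y) = star (Ψ.toAlgHom y) := map_star Ψ y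
    simp only [TensorProduct.star_tmul, Algebra.TensorProduct.map_tmul, h1, h2]

theorem tensorMap_supportProj (Φ : M₁ →⋆ₐ[ℂ] L₁) (Ψ : M₂ →⋆ₐ[ℂ] L₂) :
    Algebra.TensorProduct.map Φ.toAlgHom Ψ.toAlgHom (supportProj β γ) =
      supportProj (Φ.comp β) (Ψ.comp γ) := by
  refine IsSupport.unique ?_ (supportProj_spec _ _)
  have hs := supportProj_spec β γ
  set F := Algebra.TensorProduct.map Φ.toAlgHom Ψ.toAlgHom with hF
  have hmem : ∀ z ∈ balanced β γ, ∀ w, F z * w ∈ balanced (Φ.comp β) (Ψ.comp γ) := by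
    intro z hz w
    refine Submodule.span_induction ?_ (by simp)
      (fun x y _ _ hx hy => by rw [map_add, add_mul]; exact add_mem hx hy)
      (fun c x _ hx => by
        rw [map_smul, smul_mul_assoc]; exact Submodule.smul_mem _ c hx) hz
    rintro _ ⟨n, x, y, rfl⟩
    induction w with
    | zero => simp
    | add v w hv hw => rw [mul_add]; exact add_mem hv hw
    | tmul p q =>
      refine Submodule.subset_span ⟨n, Φ x * p, Ψ y * q, ?_⟩
      simp [hF, sub_mul, mul_assoc]
  refine ⟨by rw [← map_mul, hs.idem], by rw [← tensorMap_star, hs.star_eq], fun z => ?_⟩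
  rw [relMk_eq_zero]
  constructor
  · intro h
    have := hmem _ (hs.sub_mul_mem 1) z
    rwa [mul_one, map_sub, map_one, sub_mul, one_mul, h, sub_zero] at this
  · refine mul_balanced fun n => ?_
    have h0 : (β (.op n) * 1) ⊗ₜ[ℂ] (1 : M₂) - (1 : M₁) ⊗ₜ[ℂ] (γ n * 1) ∈ balanced β γ :=
      Submodule.subset_span ⟨n, 1, 1, rfl⟩
    have h1 := congrArg F (hs.mul_eq_zero h0)
    rw [mul_sub, map_sub, map_mul, map_mul, map_zero, sub_eq_zero] at h1
    simpa [hF] using h1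

/-- The map `Φ β*γ Ψ : M₁ β*γ M₂ → L₁ β'*γ' L₂`, where `β' = Φ ∘ β` and `γ' = Ψ ∘ γ`: the
restriction of `Φ ⊗ Ψ`. -/
noncomputable def map (Φ : M₁ →⋆ₐ[ℂ] L₁) (Ψ : M₂ →⋆ₐ[ℂ] L₂) :
    FiberedProduct β γ →⋆ₐ[ℂ] FiberedProduct (Φ.comp β) (Ψ.comp γ) where
  toFun x := ⟨Algebra.TensorProduct.map Φ.toAlgHom Ψ.toAlgHom x.1, by
    constructor
    · rw [← tensorMap_supportProj, ← map_mul, x.2.1]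
    · rw [← tensorMap_supportProj, ← map_mul, x.2.2]⟩
  map_one' := Subtype.ext (tensorMap_supportProj Φ Ψ)
  map_mul' x y := Subtype.ext (map_mul (Algebra.TensorProduct.map Φ.toAlgHom Ψ.toAlgHom) x.1 y.1)
  map_zero' := Subtype.ext (map_zero (Algebra.TensorProduct.map Φ.toAlgHom Ψ.toAlgHom))
  map_add' x y := Subtype.ext (map_add (Algebra.TensorProduct.map Φ.toAlgHom Ψ.toAlgHom) x.1 y.1)
  commutes' c := by
    refine Subtype.ext ?_
    rw [Algebra.algebraMap_eq_smul_one, Algebra.algebraMap_eq_smul_one]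
    change Algebra.TensorProduct.map Φ.toAlgHom Ψ.toAlgHom (c • supportProj β γ) =
      c • supportProj (Φ.comp β) (Ψ.comp γ)
    rw [map_smul, tensorMap_supportProj]
  map_star' x := Subtype.ext (tensorMap_star Φ Ψ x.1)

/-- The operator `x β⊗γ y` on the relative tensor product, for `x ∈ M₁'` and `y ∈ M₂'`. -/
noncomputable def commTensor (x : Module.End ℂ M₁) (y : Module.End ℂ M₂)
    (hx : ∀ a z, x (a * z) = a * x z) (hy : ∀ a z, y (a * z) = a * y z) :
    Module.End ℂ (RelTensor β γ) :=
  Submodule.mapQ _ _ (TensorProduct.map x y) (Submodule.span_le.2 (by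
    rintro _ ⟨n, p, q, rfl⟩
    refine Submodule.subset_span ⟨n, x p, y q, ?_⟩
    simp [hx, hy]))

theorem commTensor_relMk (x : Module.End ℂ M₁) (y : Module.End ℂ M₂)
    (hx : ∀ a z, x (a * z) = a * x z) (hy : ∀ a z, y (a * z) = a * y z) (w : M₁ ⊗[ℂ] M₂) :
    commTensor (β := β) (γ := γ) x y hx hy (relMk β γ w) = relMk β γ (w * (x 1 ⊗ₜ y 1)) := by
  change relMk β γ (TensorProduct.map x y w) = _
  congr 1
  induction w with
  | zero => simp
  | add v w hv hw => rw [map_add, hv, hw, add_mul]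
  | tmul p q =>
    rw [TensorProduct.map_tmul, Algebra.TensorProduct.tmul_mul_tmul, ← hx, ← hy, mul_one, mul_one]

/-- The fibered product is the commutant, on the relative tensor product of the standard
representations, of the algebra generated by the operators `x β⊗γ y` (`x ∈ M₁'`, `y ∈ M₂'`). -/
theorem mem_commutant_iff (T : Module.End ℂ (RelTensor β γ)) :
    (∀ x y hx hy, T ∘ₗ commTensor x y hx hy = commTensor x y hx hy ∘ₗ T) ↔
      ∃! z : FiberedProduct β γ, ∀ w, T (relMk β γ w) = relMk β γ (incl β γ z * w) := by
  have hs := supportProj_spec β γ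
  have hsurj : Function.Surjective (relMk β γ) := Submodule.mkQ_surjective _
  have he : ∀ w, relMk β γ (supportProj β γ * w) = relMk β γ w := by
    intro w
    have := (relMk_eq_zero β γ _).2 (hs.sub_mul_mem w)
    rw [map_sub, sub_eq_zero] at this
    exact this.symm
  constructor
  · intro h
    obtain ⟨a, ha⟩ := hsurj (T (relMk β γ 1))
    have hT : ∀ w, T (relMk β γ w) = relMk β γ (a * w) := by
      intro w
      induction w with
      | zero => simp
      | add v w hv hw => rw [map_add, map_add, hv, hw, mul_add, map_add]
      | tmul p q =>
        have hx : ∀ b z : M₁, LinearMap.mulRight ℂ p (b * z) = b * LinearMap.mulRight ℂ p z :=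
          fun b z => mul_assoc _ _ _
        have hy : ∀ b z : M₂, LinearMap.mulRight ℂ q (b * z) = b * LinearMap.mulRight ℂ q z :=
          fun b z => mul_assoc _ _ _
        have h1 := LinearMap.congr_fun (h _ _ hx hy) (relMk β γ 1)
        rw [LinearMap.comp_apply, LinearMap.comp_apply, ← ha, commTensor_relMk,
          commTensor_relMk] at h1
        simpa using h1
    refine ⟨⟨supportProj β γ * a * supportProj β γ, by
        rw [← mul_assoc, ← mul_assoc, hs.idem], by rw [mul_assoc, hs.idem]⟩, fun w => ?_, ?_⟩
    · change _ = relMk β γ (supportProj β γ * a * supportProj β γ * w)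
      rw [mul_assoc, mul_assoc, he, ← hT, he]
    · intro z hz
      refine Subtype.ext ?_
      change z.1 = supportProj β γ * a * supportProj β γ
      have h1 : relMk β γ (z.1 - a * supportProj β γ) = 0 := by
        rw [map_sub, sub_eq_zero, ← hT]
        have := hz (supportProj β γ)
        rw [this]
        change relMk β γ z.1 = relMk β γ (z.1 * supportProj β γ)
        rw [z.2.2]
      rw [← hs.ker, mul_sub, z.2.1, ← mul_assoc, sub_eq_zero] at h1
      exact h1
  · rintro ⟨z, hz, -⟩ x y hx hy
    refine LinearMap.ext fun v => ?_
    obtain ⟨w, rfl⟩ := hsurj v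
    rw [LinearMap.comp_apply, LinearMap.comp_apply, commTensor_relMk, hz, hz, commTensor_relMk,
      mul_assoc]

end FiberedProduct

end FiberedProduct

section Bialgebra

/-- An anti-`*`-homomorphism `S : M → M` (encoded as a `*`-homomorphism into the opposite algebra)
as a linear map. -/
def antiLin {M : Type*} [Ring M] [StarRing M] [Algebra ℂ M] [StarModule ℂ M]
    (S : M →⋆ₐ[ℂ] Mᵐᵒᵖ) : M →ₗ[ℂ] M :=
  (MulOpposite.opLinearEquiv ℂ).symm.toLinearMap ∘ₗ S.toAlgHom.toLinearMap

/-- A generalized C*-bialgebra `(M, Δ)`: the coproduct is an injective, not necessarily unital,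
coassociative `*`-homomorphism. -/
structure GenBialgebra (M : Type u) [CStarAlgebra M] [FiniteDimensional ℂ M] where
  Δ : M →⋆ₙₐ[ℂ] M ⊗[ℂ] M
  Δ_injective : Function.Injective Δ
  coassoc : ∀ x,
    TensorProduct.assoc ℂ M M M (TensorProduct.map (Δ : M →ₗ[ℂ] M ⊗[ℂ] M) LinearMap.id (Δ x)) =
      TensorProduct.map LinearMap.id (Δ : M →ₗ[ℂ] M ⊗[ℂ] M) (Δ x)

/-- A generalized coinvolutive C*-bialgebra `(M, Δ, S)`. -/
structure GenCoinvBialgebra (M : Type u) [CStarAlgebra M] [FiniteDimensional ℂ M]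
    extends GenBialgebra M where
  S : M →⋆ₐ[ℂ] Mᵐᵒᵖ
  S_S : ∀ x, antiLin S (antiLin S x) = x
  Δ_S : ∀ x, TensorProduct.map (antiLin S) (antiLin S) (Δ x) =
    TensorProduct.comm ℂ M M (Δ (antiLin S x))

namespace GenCoinvBialgebra

variable {M : Type u} [CStarAlgebra M] [FiniteDimensional ℂ M] (A : GenCoinvBialgebra M)

/-- The source Cartan subalgebra. -/
def sourceCartan : Set M :=
  {x | A.Δ x = A.Δ 1 * ((1 : M) ⊗ₜ[ℂ] x) ∧ A.Δ x = ((1 : M) ⊗ₜ[ℂ] x) * A.Δ 1}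

/-- The target Cartan subalgebra. -/
def targetCartan : Set M :=
  {x | A.Δ x = A.Δ 1 * (x ⊗ₜ[ℂ] (1 : M)) ∧ A.Δ x = (x ⊗ₜ[ℂ] (1 : M)) * A.Δ 1}

/-- The target counital map `μ (id ⊗ S) Δ`. -/
noncomputable def targetCounit : M →ₗ[ℂ] M :=
  LinearMap.mul' ℂ M ∘ₗ TensorProduct.map LinearMap.id (antiLin A.S) ∘ₗ
    (A.Δ : M →ₗ[ℂ] M ⊗[ℂ] M)

/-- The axioms of a counital generalized C*-bialgebra. -/
structure IsCounital : Prop where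
  counit_one : A.targetCounit 1 = 1
  counit_mem : ∀ x, A.targetCounit x ∈ A.targetCartan
  id_counit : ∀ x ∈ A.sourceCartan,
    TensorProduct.map LinearMap.id A.targetCounit (A.Δ x) = A.Δ 1 * (x ⊗ₜ[ℂ] (1 : M))

end GenCoinvBialgebra

/-- A generalized counital C*-bialgebra, bundled. -/
structure CounitalBialgebra : Type (u + 1) where
  M : Type u
  [cstar : CStarAlgebra M]
  [finDim : FiniteDimensional ℂ M]
  str : GenCoinvBialgebra M
  counital : str.IsCounital

attribute [instance] CounitalBialgebra.cstar CounitalBialgebra.finDim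

namespace CounitalBialgebra

/-- A morphism of generalized counital C*-bialgebras: a unital `*`-homomorphism which intertwines
the coproducts and the coinvolutions. -/
@[ext]
structure Hom (A B : CounitalBialgebra.{u}) where
  π : A.M →⋆ₐ[ℂ] B.M
  map_Δ : ∀ x, TensorProduct.map π.toAlgHom.toLinearMap π.toAlgHom.toLinearMap (A.str.Δ x) =
    B.str.Δ (π x)
  map_S : ∀ x, π (antiLin A.str.S x) = antiLin B.str.S (π x)

instance : Category CounitalBialgebra.{u} where
  Hom := Hom
  id A :=
    { π := StarAlgHom.id ℂ A.M
      map_Δ := fun x => by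
        change TensorProduct.map LinearMap.id LinearMap.id (A.str.Δ x) = A.str.Δ x
        rw [TensorProduct.map_id, LinearMap.id_apply]
      map_S := fun _ => rfl }
  comp {A B C} f g :=
    { π := g.π.comp f.π
      map_Δ := fun x => by
        change TensorProduct.map (g.π.toAlgHom.toLinearMap ∘ₗ f.π.toAlgHom.toLinearMap)
          (g.π.toAlgHom.toLinearMap ∘ₗ f.π.toAlgHom.toLinearMap) (A.str.Δ x) =
          C.str.Δ (g.π (f.π x))
        rw [TensorProduct.map_comp, LinearMap.comp_apply, f.map_Δ, g.map_Δ]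
      map_S := fun x => by
        change g.π (f.π (antiLin A.str.S x)) = antiLin C.str.S (g.π (f.π x))
        rw [f.map_S, g.map_S] }
  id_comp _ := rfl
  comp_id _ := rfl
  assoc _ _ _ := rfl

end CounitalBialgebra

end Bialgebra

section HopfBimodule

open FiberedProduct

/-- A Hopf bimodule `(N, M, t, s, Δ)`. The anti-`*`-homomorphism `s` is encoded as a
`*`-homomorphism on the opposite algebra of `N`. -/
structure HopfBimodule (N M : Type u) [CStarAlgebra N] [FiniteDimensional ℂ N]
    [CStarAlgebra M] [FiniteDimensional ℂ M] where
  t : N →⋆ₐ[ℂ] M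
  s : Nᵐᵒᵖ →⋆ₐ[ℂ] M
  Δ : M →⋆ₐ[ℂ] FiberedProduct s t
  t_injective : Function.Injective t
  s_injective : Function.Injective s
  Δ_injective : Function.Injective Δ
  s_t_comm : ∀ n n', s (.op n) * t n' = t n' * s (.op n)
  Δ_t : ∀ n, Δ (t n) = elem s t (t n) 1
  Δ_s : ∀ n, Δ (s (.op n)) = elem s t 1 (s (.op n))
  /-- Coassociativity. The maps `Δ * id` and `id * Δ` take values in `(M * M) * M`, respectively
  `M * (M * M)`; both of these algebras are viewed in `M ⊗ M ⊗ M`. -/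
  coassoc : ∀ x,
    TensorProduct.assoc ℂ M M M (TensorProduct.map (incl s t : _ →ₗ[ℂ] M ⊗[ℂ] M) LinearMap.id
      (incl _ _ (FiberedProduct.map (β := s) (γ := t) Δ (StarAlgHom.id ℂ M) (Δ x)))) =
    TensorProduct.map LinearMap.id (incl s t : _ →ₗ[ℂ] M ⊗[ℂ] M)
      (incl _ _ (FiberedProduct.map (β := s) (γ := t) (StarAlgHom.id ℂ M) Δ (Δ x)))

/-- A coinvolutive Hopf bimodule `(N, M, t, Δ, S)`. -/
structure CoinvHopfBimodule (N M : Type u) [CStarAlgebra N] [FiniteDimensional ℂ N]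
    [CStarAlgebra M] [FiniteDimensional ℂ M] extends HopfBimodule N M where
  S : M →⋆ₐ[ℂ] Mᵐᵒᵖ
  S_S : ∀ x, antiLin S (antiLin S x) = x
  S_t : ∀ n, antiLin S (t n) = s (.op n)
  /-- `(S * S) Δ = Σ Δ S`. The map `S * S` takes values in a fibered product of opposite algebras,
  which is viewed, like the right hand side, in the vector space `M ⊗ M`. -/
  Δ_S : ∀ x,
    TensorProduct.map (MulOpposite.opLinearEquiv ℂ).symm.toLinearMap
      (MulOpposite.opLinearEquiv ℂ).symm.toLinearMap
      (incl _ _ (FiberedProduct.map (β := s) (γ := t) S S (Δ x))) =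
    TensorProduct.comm ℂ M M (incl s t (Δ (antiLin S x)))

namespace CoinvHopfBimodule

variable {N M : Type u} [CStarAlgebra N] [FiniteDimensional ℂ N]
  [CStarAlgebra M] [FiniteDimensional ℂ M] (B : CoinvHopfBimodule N M)

/-- The target counital map `μ (id * S) Δ`, where `id * S` takes values in a subalgebra of
`M ⊗ Mᵒᵖ` and `μ (x ⊗ y) = x y`. -/
noncomputable def targetCounit (x : M) : M :=
  LinearMap.mul' ℂ M (TensorProduct.map LinearMap.id (MulOpposite.opLinearEquiv ℂ).symm.toLinearMap
    (incl _ _ (FiberedProduct.map (β := B.s) (γ := B.t) (StarAlgHom.id ℂ M) B.S (B.Δ x))))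

/-- The axioms of a counital Hopf bimodule. In the last one `M` carries the `(N, N)`-bimodule
structure `n · x · n' = t(n) s(n') x`, and `t(N)` is a bimodule over `N` through `t`. -/
structure IsCounital : Prop where
  counit_one : B.targetCounit 1 = 1
  counit_mem : ∀ x, B.targetCounit x ∈ Set.range B.t
  counit_bimodule : ∀ n n' x,
    B.targetCounit (B.t n * B.s (.op n') * x) = B.t n * B.targetCounit x * B.t n'

end CoinvHopfBimodule

/-- A counital Hopf bimodule, bundled. -/
structure CounitalHopfBimodule : Type (u + 1) where
  N : Type u
  M : Type u
  [cstarN : CStarAlgebra N]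
  [finDimN : FiniteDimensional ℂ N]
  [cstarM : CStarAlgebra M]
  [finDimM : FiniteDimensional ℂ M]
  str : CoinvHopfBimodule N M
  counital : str.IsCounital

attribute [instance] CounitalHopfBimodule.cstarN CounitalHopfBimodule.finDimN
  CounitalHopfBimodule.cstarM CounitalHopfBimodule.finDimM

namespace CounitalHopfBimodule

/-- A morphism of counital Hopf bimodules: a pair of unital `*`-homomorphisms `N₁ → N₂`, `M₁ → M₂`
compatible with `t`, `Δ` and `S` (hence with `s`). The restriction of `π ⊗ π` to the fibered
product over `N₁` and the coproduct of the target are compared in `M₂ ⊗ M₂`. -/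
@[ext]
structure Hom (A B : CounitalHopfBimodule.{u}) where
  f : A.N →⋆ₐ[ℂ] B.N
  π : A.M →⋆ₐ[ℂ] B.M
  map_t : ∀ n, π (A.str.t n) = B.str.t (f n)
  map_Δ : ∀ x,
    incl _ _ (FiberedProduct.map (β := A.str.s) (γ := A.str.t) π π (A.str.Δ x)) =
      incl B.str.s B.str.t (B.str.Δ (π x))
  map_S : ∀ x, π (antiLin A.str.S x) = antiLin B.str.S (π x)

theorem incl_map_id {A : CounitalHopfBimodule.{u}} (z : FiberedProduct A.str.s A.str.t) :
    incl _ _ (FiberedProduct.map (StarAlgHom.id ℂ A.M) (StarAlgHom.id ℂ A.M) z) =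
      incl A.str.s A.str.t z := by
  change TensorProduct.map LinearMap.id LinearMap.id z.1 = z.1
  rw [TensorProduct.map_id, LinearMap.id_apply]

instance : Category CounitalHopfBimodule.{u} where
  Hom := Hom
  id A :=
    { f := StarAlgHom.id ℂ A.N
      π := StarAlgHom.id ℂ A.M
      map_t := fun _ => rfl
      map_Δ := fun x => incl_map_id (A.str.Δ x)
      map_S := fun _ => rfl }
  comp {A B C} g h :=
    { f := h.f.comp g.f
      π := h.π.comp g.π
      map_t := fun n => by
        change h.π (g.π (A.str.t n)) = C.str.t (h.f (g.f n))
        rw [g.map_t, h.map_t]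
      map_Δ := fun x => by
        refine Eq.trans ?_ (h.map_Δ (g.π x))
        change TensorProduct.map (h.π.toAlgHom.toLinearMap ∘ₗ g.π.toAlgHom.toLinearMap)
          (h.π.toAlgHom.toLinearMap ∘ₗ g.π.toAlgHom.toLinearMap) (A.str.Δ x).1 =
          TensorProduct.map h.π.toAlgHom.toLinearMap h.π.toAlgHom.toLinearMap
            (incl B.str.s B.str.t (B.str.Δ (g.π x)))
        rw [TensorProduct.map_comp, LinearMap.comp_apply, ← g.map_Δ]
        rfl
      map_S := fun x => by
        change h.π (g.π (antiLin A.str.S x)) = antiLin C.str.S (h.π (g.π x))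
        rw [g.map_S, h.map_S] }
  id_comp _ := rfl
  comp_id _ := rfl
  assoc _ _ _ := rfl

end CounitalHopfBimodule

end HopfBimodule

/-! The base of a counital Hopf bimodule is redundant: it is recovered from $(M,\Delta,S)$ as the
target Cartan subalgebra. Hence forgetting $N$ and composing $\Delta$ with the inclusion into
$M\otimes M$ (`forgetBase`) is fully faithful and essentially surjective.

Two identities, valid before any counit axiom, drive the proof:
$\varepsilon_t(yx)=y\varepsilon_t(x)$ for $y\in N_t$ and $\varepsilon_t(yx)=\varepsilon_t(x)S(y)$
for $y\in N_s$. Once $\varepsilon_t(1)=1$, the second gives $\varepsilon_t=S$ on $N_s$. For a Hopf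
bimodule, $\varepsilon_t(M)\subset t(N)$ then forces $N_s=s(N)$ and $N_t=t(N)$ (`mem_range_s`,
`mem_range_t`). So a bialgebra morphism, which preserves $N_t$, restricts to the bases.

Conversely, a counital bialgebra yields a Hopf bimodule over $N_t$, with $t$ the inclusion and
$s=S\circ t$. The crux is that $\Delta(1)$ is the support projection $e_{s,t}$ (`supportProj_eq`):
this places $\Delta$ in the fibered product and makes it unital there. The axioms of the bialgebra
put the legs of $\Delta(1)$ in $N_s$ and $N_t$, and supply the balancing and the normalization that
characterize the support. -/

/-! ### Anti-homomorphisms and tensor legs -/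

section AntiHom

variable {M : Type*} [Ring M] [StarRing M] [Algebra ℂ M] [StarModule ℂ M] (S : M →⋆ₐ[ℂ] Mᵐᵒᵖ)

theorem antiLin_one : antiLin S 1 = 1 :=
  congrArg MulOpposite.unop (map_one S)

theorem antiLin_mul (x y : M) : antiLin S (x * y) = antiLin S y * antiLin S x :=
  congrArg MulOpposite.unop (map_mul S x y)

theorem antiLin_star (x : M) : antiLin S (star x) = star (antiLin S x) :=
  congrArg MulOpposite.unop (map_star S x)

/-- Since `T` reverses products, the outer factor `y` ends up rightmost. Both module properties of
the counital map come from this identity. -/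
theorem mul'_map_id_tmul_mul {T : M →ₗ[ℂ] M} (hT : ∀ x y, T (x * y) = T y * T x)
    (x y : M) (z : M ⊗[ℂ] M) :
    LinearMap.mul' ℂ M (TensorProduct.map LinearMap.id T ((x ⊗ₜ y) * z)) =
      x * LinearMap.mul' ℂ M (TensorProduct.map LinearMap.id T z) * T y := by
  induction z with
  | zero => simp
  | add z w hz hw => simp only [mul_add, map_add, add_mul, hz, hw]
  | tmul p q => simp [hT, mul_assoc]

theorem map_antiLin_mul_tmul (x y : M) (z : M ⊗[ℂ] M) :
    TensorProduct.map (antiLin S) (antiLin S) (z * (x ⊗ₜ y)) =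
      (antiLin S x ⊗ₜ antiLin S y) * TensorProduct.map (antiLin S) (antiLin S) z := by
  induction z with
  | zero => simp
  | add z w hz hw => simp only [mul_add, map_add, add_mul, hz, hw]
  | tmul p q => simp [antiLin_mul]

theorem map_antiLin_tmul_mul (x y : M) (z : M ⊗[ℂ] M) :
    TensorProduct.map (antiLin S) (antiLin S) ((x ⊗ₜ y) * z) =
      TensorProduct.map (antiLin S) (antiLin S) z * (antiLin S x ⊗ₜ antiLin S y) := by
  induction z with
  | zero => simp
  | add z w hz hw => simp only [mul_add, map_add, add_mul, hz, hw]
  | tmul p q => simp [antiLin_mul]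

theorem comm_mul (z w : M ⊗[ℂ] M) :
    TensorProduct.comm ℂ M M (z * w) = TensorProduct.comm ℂ M M z * TensorProduct.comm ℂ M M w :=
  map_mul (Algebra.TensorProduct.comm ℂ M M) z w

end AntiHom

/-! ### Support projections of relative tensor products -/

section SupportProj

open FiberedProduct

variable {N : Type*} [CStarAlgebra N] [FiniteDimensional ℂ N]
variable {M₁ M₂ : Type*}
  [Ring M₁] [StarRing M₁] [Algebra ℂ M₁] [StarModule ℂ M₁]
  [Ring M₂] [StarRing M₂] [Algebra ℂ M₂] [StarModule ℂ M₂]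

/-- The support projection lies in `β(N) ⊗ γ(N)`. -/
theorem exists_supportProj_eq (β : Nᵐᵒᵖ →⋆ₐ[ℂ] M₁) (γ : N →⋆ₐ[ℂ] M₂) :
    ∃ z : Nᵐᵒᵖ ⊗[ℂ] N,
      supportProj β γ = Algebra.TensorProduct.map β.toAlgHom γ.toAlgHom z :=
  -- The universal case has both structure maps equal to the identity of `N`; by naturality its
  -- support is carried to every other one.
  ⟨_, (tensorMap_supportProj (β := StarAlgHom.id ℂ Nᵐᵒᵖ) (γ := StarAlgHom.id ℂ N) β γ).symm⟩

/-- Reduces an additive property of the support to elementary tensors with legs in the two images of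
`N`. -/
theorem supportProj_induction {β : Nᵐᵒᵖ →⋆ₐ[ℂ] M₁} {γ : N →⋆ₐ[ℂ] M₂} {p : M₁ ⊗[ℂ] M₂ → Prop}
    (zero : p 0) (add : ∀ z w, p z → p w → p (z + w))
    (tmul : ∀ m n, p (β (.op m) ⊗ₜ γ n)) : p (supportProj β γ) := by
  obtain ⟨z, hz⟩ := exists_supportProj_eq β γ
  rw [hz]
  clear hz
  induction z with
  | zero => rw [map_zero]; exact zero
  | add z w hz hw => rw [map_add]; exact add _ _ hz hw
  | tmul m n => exact tmul m.unop n

theorem supportProj_mul_tmul_one {β : Nᵐᵒᵖ →⋆ₐ[ℂ] M₁} {γ : N →⋆ₐ[ℂ] M₂} (n : N) :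
    supportProj β γ * (β (.op n) ⊗ₜ 1) = supportProj β γ * (1 ⊗ₜ γ n) := by
  have h : (β (.op n) * 1) ⊗ₜ[ℂ] (1 : M₂) - (1 : M₁) ⊗ₜ[ℂ] (γ n * 1) ∈ balanced β γ :=
    Submodule.subset_span ⟨n, 1, 1, rfl⟩
  have h := (supportProj_spec β γ).mul_eq_zero h
  rwa [mul_sub, sub_eq_zero, mul_one, mul_one] at h

/-- Only the first leg of the support meets `x`, and that leg lies in the range of `β`. -/
theorem tmul_one_mul_supportProj {β : Nᵐᵒᵖ →⋆ₐ[ℂ] M₁} {γ : N →⋆ₐ[ℂ] M₂} {x : M₁}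
    (hx : ∀ n, β (.op n) * x = x * β (.op n)) :
    (x ⊗ₜ 1) * supportProj β γ = supportProj β γ * (x ⊗ₜ 1) := by
  refine supportProj_induction (p := fun e => (x ⊗ₜ 1) * e = e * (x ⊗ₜ 1))
    (by rw [mul_zero, zero_mul]) (fun z w hz hw => ?_) (fun m n => ?_)
  · rw [mul_add, add_mul, hz, hw]
  · simp [hx]

/-- A projection of `β(N) ⊗ γ(N)` which balances `β` and `γ` and which the balanced multiplication
maps to `1` is the support. -/
theorem isSupport_of_sum {β : Nᵐᵒᵖ →⋆ₐ[ℂ] M₁} {γ : N →⋆ₐ[ℂ] M₂} {e : M₁ ⊗[ℂ] M₂}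
    (idem : e * e = e) (star_eq : star e = e)
    (hbal : ∀ n, e * (β (.op n) ⊗ₜ 1) = e * (1 ⊗ₜ γ n))
    {ι : Type*} (I : Finset ι) (p q : ι → N) (he : e = ∑ i ∈ I, β (.op (p i)) ⊗ₜ γ (q i))
    (hone : ∑ i ∈ I, p i * q i = 1) : IsSupport β γ e := by
  refine ⟨idem, star_eq, fun z => ?_⟩
  rw [relMk_eq_zero]
  refine ⟨fun h => ?_, mul_balanced hbal⟩
  -- Insert $1=\sum p_iq_i$ in the second leg and move each $p_i$ across the tensor sign, modulo
  -- balanced vectors.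
  have hsub : z - e * z ∈ balanced β γ := by
    clear h
    induction z with
    | zero => simp
    | add z w hz hw => rw [mul_add, add_sub_add_comm]; exact add_mem hz hw
    | tmul x y =>
      have h1 : x ⊗ₜ[ℂ] y = ∑ i ∈ I, x ⊗ₜ[ℂ] (γ (p i) * (γ (q i) * y)) := by
        rw [← TensorProduct.tmul_sum]
        simp only [← mul_assoc, ← map_mul]
        rw [← Finset.sum_mul, ← map_sum, hone, map_one, one_mul]
      have h2 : e * (x ⊗ₜ[ℂ] y) = ∑ i ∈ I, (β (.op (p i)) * x) ⊗ₜ[ℂ] (γ (q i) * y) := by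
        simp only [he, Finset.sum_mul, Algebra.TensorProduct.tmul_mul_tmul]
      rw [h2, h1, ← Finset.sum_sub_distrib]
      refine sum_mem fun i _ => ?_
      rw [← neg_sub]
      exact neg_mem (Submodule.subset_span ⟨p i, x, γ (q i) * y, rfl⟩)
  rwa [h, sub_zero] at hsub

end SupportProj

/-! ### Cartan subalgebras and the counital map -/

namespace GenCoinvBialgebra

variable {M : Type u} [CStarAlgebra M] [FiniteDimensional ℂ M] (A : GenCoinvBialgebra M)

theorem one_mul_Δ (x : M) : A.Δ 1 * A.Δ x = A.Δ x := by rw [← map_mul, one_mul]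

theorem Δ_mul_one (x : M) : A.Δ x * A.Δ 1 = A.Δ x := by rw [← map_mul, mul_one]

theorem Δ_antiLin (x : M) : A.Δ (antiLin A.S x) =
    TensorProduct.comm ℂ M M (TensorProduct.map (antiLin A.S) (antiLin A.S) (A.Δ x)) := by
  rw [A.Δ_S]
  exact ((TensorProduct.comm ℂ M M).symm_apply_apply _).symm

theorem Δ_one_eq : TensorProduct.comm ℂ M M
    (TensorProduct.map (antiLin A.S) (antiLin A.S) (A.Δ 1)) = A.Δ 1 := by
  rw [← Δ_antiLin, antiLin_one]

/-- $\Delta(1)$ is fixed by $\varsigma(S\otimes S)$, which reverses products and swaps legs; the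
left and right defining conditions are therefore exchanged. -/
theorem antiLin_mem_sourceCartan {x : M} (hx : x ∈ A.targetCartan) :
    antiLin A.S x ∈ A.sourceCartan := by
  constructor
  · rw [Δ_antiLin, hx.2, map_antiLin_tmul_mul, comm_mul, Δ_one_eq, TensorProduct.comm_tmul,
      antiLin_one]
  · rw [Δ_antiLin, hx.1, map_antiLin_mul_tmul, comm_mul, Δ_one_eq, TensorProduct.comm_tmul,
      antiLin_one]

theorem Δ_target_mul {y : M} (hy : y ∈ A.targetCartan) (x : M) :
    A.Δ (y * x) = (y ⊗ₜ 1) * A.Δ x := by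
  rw [map_mul, hy.2, mul_assoc, one_mul_Δ]

theorem Δ_mul_target {y : M} (hy : y ∈ A.targetCartan) (x : M) :
    A.Δ (x * y) = A.Δ x * (y ⊗ₜ 1) := by
  rw [map_mul, hy.1, ← mul_assoc, Δ_mul_one]

theorem Δ_source_mul {y : M} (hy : y ∈ A.sourceCartan) (x : M) :
    A.Δ (y * x) = (1 ⊗ₜ y) * A.Δ x := by
  rw [map_mul, hy.2, mul_assoc, one_mul_Δ]

/-- After applying the injective $\Delta$, the two factors act on different legs of $\Delta(1)$,
where they commute. -/
theorem source_mul_target {x y : M} (hx : x ∈ A.sourceCartan) (hy : y ∈ A.targetCartan) :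
    x * y = y * x := by
  apply A.Δ_injective
  rw [A.Δ_source_mul hx, A.Δ_target_mul hy, hy.2, hx.2, ← mul_assoc, ← mul_assoc]
  simp

theorem targetCounit_target_mul {y : M} (hy : y ∈ A.targetCartan) (x : M) :
    A.targetCounit (y * x) = y * A.targetCounit x := by
  change LinearMap.mul' ℂ M (TensorProduct.map LinearMap.id (antiLin A.S) (A.Δ (y * x))) = _
  rw [A.Δ_target_mul hy, mul'_map_id_tmul_mul (antiLin_mul A.S), antiLin_one, mul_one]
  rfl

/-- With `x = 1` and $\varepsilon_t(1)=1$, this shows that the counital map agrees with `S` on the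
source Cartan subalgebra. -/
theorem targetCounit_source_mul {y : M} (hy : y ∈ A.sourceCartan) (x : M) :
    A.targetCounit (y * x) = A.targetCounit x * antiLin A.S y := by
  change LinearMap.mul' ℂ M (TensorProduct.map LinearMap.id (antiLin A.S) (A.Δ (y * x))) = _
  rw [A.Δ_source_mul hy, mul'_map_id_tmul_mul (antiLin_mul A.S), one_mul]
  rfl

/-- The target Cartan subalgebra, as a unital `*`-subalgebra. -/
def targetSubalgebra : StarSubalgebra ℂ M where
  carrier := A.targetCartan
  mul_mem' {x y} hx hy := by
    constructor
    · rw [A.Δ_mul_target hy, hx.1, mul_assoc]; simp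
    · rw [A.Δ_target_mul hx, hy.2, ← mul_assoc]; simp
  add_mem' {x y} hx hy := by
    constructor
    · rw [map_add, TensorProduct.add_tmul, mul_add, ← hx.1, ← hy.1]
    · rw [map_add, TensorProduct.add_tmul, add_mul, ← hx.2, ← hy.2]
  algebraMap_mem' c := by
    rw [Algebra.algebraMap_eq_smul_one]
    constructor
    · rw [map_smul, ← TensorProduct.smul_tmul', mul_smul_comm, ← Algebra.TensorProduct.one_def,
        mul_one]
    · rw [map_smul, ← TensorProduct.smul_tmul', smul_mul_assoc, ← Algebra.TensorProduct.one_def,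
        one_mul]
  star_mem' {x} hx := by
    have h1 := congrArg star hx.1
    have h2 := congrArg star hx.2
    rw [star_mul, ← map_star, ← map_star, star_one, TensorProduct.star_tmul, star_one] at h1 h2
    -- The adjoint exchanges the left and right conditions, so both are needed for `*`-stability.
    exact ⟨h2, h1⟩

instance : FiniteDimensional ℂ A.targetSubalgebra :=
  inferInstanceAs (FiniteDimensional ℂ A.targetSubalgebra.toSubalgebra.toSubmodule)

/-- Closedness, automatic in finite dimension, is what lets the subalgebra inherit a C*-structure
and serve as a base. -/
instance : IsClosed (A.targetSubalgebra : Set M) :=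
  A.targetSubalgebra.toSubalgebra.toSubmodule.closed_of_finiteDimensional

noncomputable instance : CStarAlgebra A.targetSubalgebra := StarSubalgebra.cstarAlgebra _

/-- The inclusion of the target Cartan subalgebra. -/
noncomputable def target : A.targetSubalgebra →⋆ₐ[ℂ] M := A.targetSubalgebra.subtype

/-- The anti-homomorphism from the target Cartan subalgebra onto the source Cartan subalgebra. -/
noncomputable def source : (A.targetSubalgebra)ᵐᵒᵖ →⋆ₐ[ℂ] M where
  toFun x := antiLin A.S x.unop.1
  map_one' := antiLin_one A.S
  map_mul' x y := antiLin_mul A.S y.unop.1 x.unop.1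
  map_zero' := map_zero (antiLin A.S)
  map_add' x y := map_add (antiLin A.S) x.unop.1 y.unop.1
  commutes' c := by
    change antiLin A.S (algebraMap ℂ M c) = _
    rw [Algebra.algebraMap_eq_smul_one, map_smul, antiLin_one]
  map_star' x := antiLin_star A.S x.unop.1

theorem source_mem (n : A.targetSubalgebra) : A.source (.op n) ∈ A.sourceCartan :=
  A.antiLin_mem_sourceCartan n.2

/-! ### The projection Δ(1) is the support -/

variable {A}

theorem IsCounital.map_Δ_one (h : A.IsCounital) :
    TensorProduct.map LinearMap.id A.targetCounit (A.Δ 1) = A.Δ 1 := by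
  have h1 : (1 : M) ∈ A.sourceCartan := by
    constructor <;> simp [← Algebra.TensorProduct.one_def]
  rw [h.id_counit 1 h1, ← Algebra.TensorProduct.one_def, mul_one]

/-- Axiom (3) at `1` says that $\mathrm{id}\otimes\varepsilon_t$ fixes $e=\Delta(1)$, which puts the
right leg in $N_t$. Flipping by $\varsigma(S\otimes S)$ and applying it again controls the other
leg: $e=\sum a_i\otimes b_i$ gives $p_i=\varepsilon_t(b_i)$ and $q_i=\varepsilon_t(S(a_i))$. -/
theorem IsCounital.exists_Δ_one_eq (h : A.IsCounital) :
    ∃ (I : Finset (M × M)) (p q : M × M → A.targetSubalgebra),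
      A.Δ 1 = ∑ i ∈ I, A.source (.op (p i)) ⊗ₜ A.target (q i) := by
  obtain ⟨I, hI⟩ := TensorProduct.exists_finset (A.Δ 1)
  refine ⟨I, fun i => ⟨_, h.counit_mem i.2⟩, fun i => ⟨_, h.counit_mem (antiLin A.S i.1)⟩, ?_⟩
  have h1 := h.map_Δ_one
  conv_lhs at h1 => rw [hI]
  conv_lhs => rw [← h.map_Δ_one, ← A.Δ_one_eq, ← h1]
  simp only [map_sum, TensorProduct.map_tmul, TensorProduct.comm_tmul]
  rfl

/-- Axiom (3) turns the left side into $(\mathrm{id}\otimes\varepsilon_t)((1\otimes x)e)$. The right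
leg $q$ of $e$ lies in $N_t$, so it commutes with `x` and leaves $\varepsilon_t$:
$\varepsilon_t(xq)=q\varepsilon_t(x)=qS(x)$. -/
theorem IsCounital.Δ_one_mul_tmul (h : A.IsCounital) {x : M} (hx : x ∈ A.sourceCartan) :
    A.Δ 1 * (x ⊗ₜ 1) = A.Δ 1 * (1 ⊗ₜ antiLin A.S x) := by
  rw [← h.id_counit x hx, hx.2]
  obtain ⟨I, p, q, hI⟩ := h.exists_Δ_one_eq
  rw [hI, Finset.mul_sum, Finset.sum_mul, map_sum]
  refine Finset.sum_congr rfl fun i _ => ?_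
  have hq : A.target (q i) ∈ A.targetCartan := (q i).2
  have h2 : A.targetCounit x = antiLin A.S x := by
    have := A.targetCounit_source_mul hx 1
    rwa [mul_one, h.counit_one, one_mul] at this
  simp only [Algebra.TensorProduct.tmul_mul_tmul, one_mul, mul_one, TensorProduct.map_tmul,
    LinearMap.id_apply]
  rw [A.source_mul_target hx hq, A.targetCounit_target_mul hq, h2]

/-- In a counital bialgebra `Δ(1)` is the support projection of the Cartan subalgebras. -/
theorem IsCounital.supportProj_eq (h : A.IsCounital) :
    supportProj A.source A.target = A.Δ 1 := by
  refine (supportProj_spec _ _).unique ?_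
  obtain ⟨I, p, q, hI⟩ := h.exists_Δ_one_eq
  -- The order matters: $\varepsilon_t(1)=1$ will give $\sum q_ip_i=1$, so the support criterion
  -- needs the expansion with `p` and `q` interchanged.
  have hflip : A.Δ 1 = ∑ i ∈ I, A.source (.op (q i)) ⊗ₜ A.target (p i) := by
    rw [← A.Δ_one_eq, hI]
    simp only [map_sum, TensorProduct.map_tmul, TensorProduct.comm_tmul]
    refine Finset.sum_congr rfl fun i _ => ?_
    exact congrArg (fun w => A.source (.op (q i)) ⊗ₜ[ℂ] w) (A.S_S (p i).1)
  refine isSupport_of_sum (by rw [← map_mul, mul_one]) (by rw [← map_star, star_one])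
    (fun n => ?_) I q p hflip ?_
  · rw [h.Δ_one_mul_tmul (A.source_mem n)]
    exact congrArg (fun w => A.Δ 1 * ((1 : M) ⊗ₜ[ℂ] w)) (A.S_S n.1)
  · have h1 := h.counit_one
    change LinearMap.mul' ℂ M (TensorProduct.map LinearMap.id (antiLin A.S) (A.Δ 1)) = 1 at h1
    rw [hI] at h1
    simp only [map_sum, TensorProduct.map_tmul, LinearMap.mul'_apply, LinearMap.id_apply] at h1
    -- Here $\varepsilon_t(1)=\sum S(p_i)S(q_i)=S(\sum q_ip_i)$.
    have h2 : antiLin A.S (∑ i ∈ I, q i * p i : A.targetSubalgebra) = 1 := by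
      rw [← h1, AddSubmonoidClass.coe_finsetSum, map_sum]
      exact Finset.sum_congr rfl fun i _ => antiLin_mul A.S _ _
    have h3 := congrArg (antiLin A.S) h2
    rw [A.S_S, antiLin_one] at h3
    exact Subtype.ext h3

end GenCoinvBialgebra

/-! ### From Hopf bimodules to bialgebras -/

section Comparison

open FiberedProduct

namespace CoinvHopfBimodule

variable {N M : Type u} [CStarAlgebra N] [FiniteDimensional ℂ N]
  [CStarAlgebra M] [FiniteDimensional ℂ M] (B : CoinvHopfBimodule N M)

/-- The generalized coinvolutive bialgebra underlying a coinvolutive Hopf bimodule. -/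
noncomputable def toGenCoinvBialgebra : GenCoinvBialgebra M where
  Δ := (incl B.s B.t).comp (B.Δ : M →⋆ₙₐ[ℂ] FiberedProduct B.s B.t)
  Δ_injective := Subtype.val_injective.comp B.Δ_injective
  coassoc x := by
    have h := B.coassoc x
    change TensorProduct.assoc ℂ M M M (TensorProduct.map (incl B.s B.t : _ →ₗ[ℂ] M ⊗[ℂ] M)
      LinearMap.id (TensorProduct.map B.Δ.toAlgHom.toLinearMap LinearMap.id (B.Δ x).1)) =
      TensorProduct.map LinearMap.id (incl B.s B.t : _ →ₗ[ℂ] M ⊗[ℂ] M)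
        (TensorProduct.map LinearMap.id B.Δ.toAlgHom.toLinearMap (B.Δ x).1) at h
    -- Merging the inclusion with `B.Δ` in each leg turns fibered coassociativity into the ordinary
    -- one.
    rw [← LinearMap.comp_apply (TensorProduct.map _ _), ← TensorProduct.map_comp,
      ← LinearMap.comp_apply (TensorProduct.map _ _), ← TensorProduct.map_comp] at h
    exact h
  S := B.S
  S_S := B.S_S
  Δ_S x := by
    refine Eq.trans ?_ (B.Δ_S x)
    change _ = TensorProduct.map (MulOpposite.opLinearEquiv ℂ).symm.toLinearMap
      (MulOpposite.opLinearEquiv ℂ).symm.toLinearMap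
      (TensorProduct.map B.S.toAlgHom.toLinearMap B.S.toAlgHom.toLinearMap (B.Δ x).1)
    rw [← LinearMap.comp_apply (TensorProduct.map _ _), ← TensorProduct.map_comp]
    rfl

theorem toGenCoinvBialgebra_Δ_one : B.toGenCoinvBialgebra.Δ 1 = supportProj B.s B.t :=
  congrArg Subtype.val (map_one B.Δ)

theorem toGenCoinvBialgebra_targetCounit (x : M) :
    B.toGenCoinvBialgebra.targetCounit x = B.targetCounit x := by
  change _ = LinearMap.mul' ℂ M (TensorProduct.map LinearMap.id
    (MulOpposite.opLinearEquiv ℂ).symm.toLinearMap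
      (TensorProduct.map LinearMap.id B.S.toAlgHom.toLinearMap (B.Δ x).1))
  rw [← LinearMap.comp_apply (TensorProduct.map _ _), ← TensorProduct.map_comp]
  rfl

theorem S_s (n : N) : antiLin B.S (B.s (.op n)) = B.t n := by
  rw [← B.S_t, B.S_S]

/-- The ranges of `s` and `t` commute, so $t(n)\otimes1$ commutes with the support $e$ and one $e$
in $e(t(n)\otimes1)e$ is redundant. -/
theorem t_mem_targetCartan (n : N) : B.t n ∈ B.toGenCoinvBialgebra.targetCartan := by
  have h0 : B.toGenCoinvBialgebra.Δ (B.t n) =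
      supportProj B.s B.t * (B.t n ⊗ₜ 1) * supportProj B.s B.t :=
    congrArg Subtype.val (B.Δ_t n)
  have h1 := tmul_one_mul_supportProj (γ := B.t) (fun m => B.s_t_comm m n)
  have h2 := (supportProj_spec B.s B.t).idem
  constructor
  · rw [h0, toGenCoinvBialgebra_Δ_one, mul_assoc, h1, ← mul_assoc, h2]
  · rw [h0, toGenCoinvBialgebra_Δ_one, ← h1, mul_assoc, h2]

variable {B}

/-- On the source Cartan subalgebra $S(x)=\varepsilon_t(x)\in t(N)$; apply `S` once more. -/
theorem IsCounital.mem_range_s (h : B.IsCounital) {x : M}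
    (hx : x ∈ B.toGenCoinvBialgebra.sourceCartan) : ∃ n, B.s (.op n) = x := by
  have h1 := B.toGenCoinvBialgebra.targetCounit_source_mul hx 1
  rw [mul_one, B.toGenCoinvBialgebra_targetCounit, B.toGenCoinvBialgebra_targetCounit,
    h.counit_one, one_mul] at h1
  obtain ⟨n, hn⟩ := h.counit_mem x
  refine ⟨n, ?_⟩
  rw [← B.S_t, hn, h1]
  exact B.S_S x

theorem IsCounital.mem_range_t (h : B.IsCounital) {x : M}
    (hx : x ∈ B.toGenCoinvBialgebra.targetCartan) : ∃ n, B.t n = x := by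
  obtain ⟨n, hn⟩ := h.mem_range_s (B.toGenCoinvBialgebra.antiLin_mem_sourceCartan hx)
  refine ⟨n, ?_⟩
  rw [← B.S_s, hn]
  exact B.S_S x

theorem IsCounital.toGenCoinvBialgebra (h : B.IsCounital) :
    B.toGenCoinvBialgebra.IsCounital where
  counit_one := by rw [toGenCoinvBialgebra_targetCounit, h.counit_one]
  counit_mem x := by
    rw [toGenCoinvBialgebra_targetCounit]
    obtain ⟨n, hn⟩ := h.counit_mem x
    rw [← hn]
    exact B.t_mem_targetCartan n
  id_counit x hx := by
    obtain ⟨n, rfl⟩ := h.mem_range_s hx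
    rw [hx.2, toGenCoinvBialgebra_Δ_one, supportProj_mul_tmul_one]
    -- The bimodule axiom at `x = 1`; it is axiom (3) read on the right leg of the support.
    have key : ∀ m, B.toGenCoinvBialgebra.targetCounit (B.s (.op n) * B.t m) = B.t m * B.t n := by
      intro m
      have h1 := h.counit_bimodule m n 1
      rw [mul_one, h.counit_one, mul_one] at h1
      rw [toGenCoinvBialgebra_targetCounit, B.s_t_comm, h1]
    refine supportProj_induction (p := fun e =>
      TensorProduct.map LinearMap.id B.toGenCoinvBialgebra.targetCounit
        ((1 ⊗ₜ B.s (.op n)) * e) = e * (1 ⊗ₜ B.t n)) (by rw [mul_zero, map_zero, zero_mul])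
      (fun z w hz hw => ?_) (fun m k => ?_)
    · rw [mul_add, map_add, hz, hw, add_mul]
    · simp [key]

end CoinvHopfBimodule

/-- The functor which forgets the base of a counital Hopf bimodule. -/
noncomputable def forgetBase : CounitalHopfBimodule.{u} ⥤ CounitalBialgebra.{u} where
  obj B := { M := B.M, str := B.str.toGenCoinvBialgebra, counital := B.counital.toGenCoinvBialgebra }
  map g := { π := g.π, map_Δ := g.map_Δ, map_S := g.map_S }
  map_id _ := rfl
  map_comp _ _ := rfl

/-! ### Full faithfulness -/

instance : forgetBase.{u}.Faithful where
  map_injective {A B} g h hgh := by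
    have hπ : g.π = h.π := congrArg CounitalBialgebra.Hom.π hgh
    refine CounitalHopfBimodule.Hom.ext ?_ hπ
    ext n
    apply B.str.t_injective
    rw [← g.map_t, ← h.map_t, hπ]

theorem CounitalBialgebra.Hom.mem_targetCartan {A B : CounitalBialgebra.{u}} (g : Hom A B)
    {x : A.M} (hx : x ∈ A.str.targetCartan) : g.π x ∈ B.str.targetCartan := by
  have hmul : ∀ z w, TensorProduct.map g.π.toAlgHom.toLinearMap g.π.toAlgHom.toLinearMap (z * w) =
      TensorProduct.map g.π.toAlgHom.toLinearMap g.π.toAlgHom.toLinearMap z *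
        TensorProduct.map g.π.toAlgHom.toLinearMap g.π.toAlgHom.toLinearMap w :=
    fun z w => map_mul (Algebra.TensorProduct.map g.π.toAlgHom g.π.toAlgHom) z w
  have h1 : TensorProduct.map g.π.toAlgHom.toLinearMap g.π.toAlgHom.toLinearMap (x ⊗ₜ 1) =
      g.π x ⊗ₜ 1 := congrArg (fun w => g.π x ⊗ₜ[ℂ] w) (map_one g.π)
  constructor
  · rw [← g.map_Δ, hx.1, hmul, g.map_Δ, map_one, h1]
  · rw [← g.map_Δ, hx.2, hmul, g.map_Δ, map_one, h1]

/-- The factorization of a `*`-homomorphism through an injective one with larger range. -/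
noncomputable def StarAlgHom.factor {K L R : Type*} [Ring K] [StarRing K] [Algebra ℂ K]
    [Ring L] [StarRing L] [Algebra ℂ L] [Ring R] [StarRing R] [Algebra ℂ R]
    (i : L →⋆ₐ[ℂ] R) (hi : Function.Injective i) (g : K →⋆ₐ[ℂ] R) (h : ∀ x, ∃ y, i y = g x) :
    K →⋆ₐ[ℂ] L where
  toFun x := (h x).choose
  map_one' := hi (by rw [(h _).choose_spec, map_one, map_one])
  map_mul' x y := hi (by
    rw [map_mul i, (h _).choose_spec, (h _).choose_spec, (h _).choose_spec, map_mul])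
  map_zero' := hi (by rw [(h _).choose_spec, map_zero, map_zero])
  map_add' x y := hi (by
    rw [map_add i, (h _).choose_spec, (h _).choose_spec, (h _).choose_spec, map_add])
  commutes' c := hi (by
    rw [(h _).choose_spec, AlgHomClass.commutes g, AlgHomClass.commutes i])
  map_star' x := hi (by rw [map_star i, (h _).choose_spec, (h _).choose_spec, map_star])

instance : forgetBase.{u}.Full where
  map_surjective {A B} g := by
    let π : A.M →⋆ₐ[ℂ] B.M := g.π
    -- `π` preserves target Cartan subalgebras, and that of `B` is the range of its `t`: this
    -- determines the map of bases.
    have h : ∀ n, ∃ m, B.str.t m = π.comp A.str.t n := fun n =>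
      B.counital.mem_range_t (g.mem_targetCartan (A.str.t_mem_targetCartan n))
    exact ⟨{ f := StarAlgHom.factor B.str.t B.str.t_injective (π.comp A.str.t) h
             π := π
             map_t := fun n => (h n).choose_spec.symm
             map_Δ := g.map_Δ
             map_S := g.map_S }, rfl⟩

/-! ### Reconstruction of the base and essential surjectivity -/

namespace GenCoinvBialgebra

variable {M : Type u} [CStarAlgebra M] [FiniteDimensional ℂ M] {A : GenCoinvBialgebra M}

/-- The coproduct of a counital bialgebra, with values in the fibered product over the target Cartan
subalgebra. -/
noncomputable def IsCounital.fiberedΔ (h : A.IsCounital) :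
    M →⋆ₐ[ℂ] FiberedProduct A.source A.target where
  toFun x := ⟨A.Δ x, by rw [h.supportProj_eq, one_mul_Δ], by rw [h.supportProj_eq, Δ_mul_one]⟩
  -- The unit of the fibered product is the support projection, so unitality is exactly its
  -- identification with $\Delta(1)$.
  map_one' := Subtype.ext h.supportProj_eq.symm
  map_mul' x y := Subtype.ext (map_mul A.Δ x y)
  map_zero' := Subtype.ext (map_zero A.Δ)
  map_add' x y := Subtype.ext (map_add A.Δ x y)
  commutes' c := by
    refine Subtype.ext ?_
    rw [Algebra.algebraMap_eq_smul_one, Algebra.algebraMap_eq_smul_one]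
    change A.Δ (c • 1) = c • supportProj A.source A.target
    rw [map_smul, h.supportProj_eq]
  map_star' x := Subtype.ext (map_star A.Δ x)

/-- The Hopf bimodule of a counital bialgebra over its target Cartan subalgebra. -/
noncomputable def IsCounital.toCoinvHopfBimodule (h : A.IsCounital) :
    CoinvHopfBimodule A.targetSubalgebra M where
  t := A.target
  s := A.source
  Δ := h.fiberedΔ
  t_injective := Subtype.val_injective
  s_injective x y hxy := by
    have h1 := congrArg (antiLin A.S) hxy
    change antiLin A.S (antiLin A.S _) = antiLin A.S (antiLin A.S _) at h1
    rw [A.S_S, A.S_S] at h1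
    exact MulOpposite.unop_injective (Subtype.ext h1)
  Δ_injective x y hxy := A.Δ_injective (congrArg Subtype.val hxy)
  s_t_comm n n' := A.source_mul_target (A.source_mem n) n'.2
  Δ_t n := by
    refine Subtype.ext ?_
    change A.Δ n.1 =
      supportProj A.source A.target * (n.1 ⊗ₜ 1) * supportProj A.source A.target
    rw [h.supportProj_eq, ← n.2.1, Δ_mul_one]
  Δ_s n := by
    refine Subtype.ext ?_
    change A.Δ (A.source (.op n)) =
      supportProj A.source A.target * (1 ⊗ₜ A.source (.op n)) * supportProj A.source A.target
    rw [h.supportProj_eq, ← (A.source_mem n).1, Δ_mul_one]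
  coassoc x := by
    change TensorProduct.assoc ℂ M M M
      (TensorProduct.map (incl A.source A.target : _ →ₗ[ℂ] M ⊗[ℂ] M) LinearMap.id
        (TensorProduct.map h.fiberedΔ.toAlgHom.toLinearMap LinearMap.id (A.Δ x))) =
      TensorProduct.map LinearMap.id (incl A.source A.target : _ →ₗ[ℂ] M ⊗[ℂ] M)
        (TensorProduct.map LinearMap.id h.fiberedΔ.toAlgHom.toLinearMap (A.Δ x))
    rw [← LinearMap.comp_apply (TensorProduct.map _ _), ← TensorProduct.map_comp,
      ← LinearMap.comp_apply (TensorProduct.map _ _), ← TensorProduct.map_comp]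
    exact A.coassoc x
  S := A.S
  S_S := A.S_S
  S_t _ := rfl
  Δ_S x := by
    refine Eq.trans ?_ (A.Δ_S x)
    change TensorProduct.map (MulOpposite.opLinearEquiv ℂ).symm.toLinearMap
      (MulOpposite.opLinearEquiv ℂ).symm.toLinearMap
      (TensorProduct.map A.S.toAlgHom.toLinearMap A.S.toAlgHom.toLinearMap (A.Δ x)) = _
    rw [← LinearMap.comp_apply (TensorProduct.map _ _), ← TensorProduct.map_comp]
    rfl

/-- Forgetting the reconstructed base returns `A` definitionally, so the comparison of counital maps
can be read backwards. -/
theorem IsCounital.toCoinvHopfBimodule_targetCounit (h : A.IsCounital) (x : M) :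
    h.toCoinvHopfBimodule.targetCounit x = A.targetCounit x :=
  (h.toCoinvHopfBimodule.toGenCoinvBialgebra_targetCounit x).symm

theorem IsCounital.toCoinvHopfBimodule_isCounital (h : A.IsCounital) :
    h.toCoinvHopfBimodule.IsCounital where
  counit_one := by rw [h.toCoinvHopfBimodule_targetCounit, h.counit_one]
  counit_mem x := by
    rw [h.toCoinvHopfBimodule_targetCounit]
    exact ⟨⟨_, h.counit_mem x⟩, rfl⟩
  counit_bimodule n n' x := by
    rw [h.toCoinvHopfBimodule_targetCounit, h.toCoinvHopfBimodule_targetCounit, mul_assoc, mul_assoc]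
    -- The two module identities pull out $t(n)$ on the left and $S(s(n'))=t(n')$ on the right.
    refine (A.targetCounit_target_mul n.2 _).trans ?_
    refine congrArg (n.1 * ·) ((A.targetCounit_source_mul (A.source_mem n') x).trans ?_)
    exact congrArg (A.targetCounit x * ·) (A.S_S n'.1)

end GenCoinvBialgebra

/-- The preimage is taken over the target Cartan subalgebra; its image is `A` on the nose, so the
identity isomorphism suffices. -/
instance : forgetBase.{u}.EssSurj where
  mem_essImage A :=
    ⟨{ N := A.str.targetSubalgebra
       M := A.M
       str := A.counital.toCoinvHopfBimodule
       counital := A.counital.toCoinvHopfBimodule_isCounital }, ⟨Iso.refl A⟩⟩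

end Comparison

theorem mainTheorem11 :
    Nonempty (CategoryTheory.Equivalence CounitalHopfBimodule.{u} CounitalBialgebra.{u}) := by
  exact ⟨@Functor.asEquivalence _ _ _ _ forgetBase { }⟩
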